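/- Let $\mu_0,\mu_1$ be compactly supported Borel probability measures on $\mathbb R^{d_0}$ and $\mathbb R^{d_1}$, and let $\Pi(\mu_0,\mu_1)$ be the set of their couplings. For $\bm A\in\mathbb R^{d_0\times d_1}$ let $\mathsf{OT}_{\bm A,0}(\mu_0,\mu_1)=\inf_{\pi\in\Pi(\mu_0,\mu_1)}\int c_{\bm A}\,d\pi$ with $c_{\bm A}(x,y)=-4\|x\|^2\|y\|^2-32\,x^{\intercal}\bm A y$, and let $\Phi_0(\bm A)=32\|\bm A\|_F^2+\mathsf{OT}_{\bm A,0}(\mu_0,\mu_1)$, where $\|\cdot\|_F$ is the Frobenius norm. Let $M_2(\mu)=\int\|x\|^2\,d\mu(x)$, $M_{\mu_0,\mu_1}=\sqrt{M_2(\mu_0)M_2(\mu_1)}$ and $\mathcal D_M=\{\bm A\in\mathbb R^{d_0\times d_1}:\|\bm A\|_F\le M/2\}$. Let $\mathsf S_0(\mu_0,\mu_1)$ denote the quadratic Gromov–Wasserstein problem $$\inf_{\pi\in\Pi(\mu_0,\mu_1)}\int\big|\|x-x'\|^2-\|y-y'\|^2\big|^2\,d\pi\otimes\pi(x,y,x',y').$$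 If $\bar{\bm A}$ is a local minimizer of $\Phi_0$, then there exists $\bar\pi\in\Pi(\mu_0,\mu_1)$ that is optimal for $\mathsf{OT}_{\bar{\bm A},0}(\mu_0,\mu_1)$ and satisfies $\bar{\bm A}=\frac12\int xy^{\intercal}\,d\bar\pi(x,y)$; moreover $\bar{\bm A}\in\mathcal D_M$ for every $M>M_{\mu_0,\mu_1}$. If in addition $\bar{\bm A}$ is a global minimizer of $\Phi_0$ and $\mu_0,\mu_1$ are centered (i.e. $\int x\,d\mu_0=0$ and $\int y\,d\mu_1=0$), then every such $\bar\pi$ is optimal for $\mathsf S_0(\mu_0,\mu_1)$. -/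

import Mathlib

open MeasureTheory Matrix

-- `‖A‖` for a real matrix `A` is the Frobenius norm.
attribute [local instance] Matrix.frobeniusNormedAddCommGroup

noncomputable section

namespace GromovWasserstein

/-- The Euclidean space `ℝ^d`. -/
abbrev Euc (d : ℕ) : Type := EuclideanSpace ℝ (Fin d)

/-- The set `Π(μ₀, μ₁)` of couplings of `μ₀` and `μ₁`: the measures on the product space with
marginals `μ₀` and `μ₁`. -/
def couplings {d₀ d₁ : ℕ} (μ₀ : Measure (Euc d₀)) (μ₁ : Measure (Euc d₁)) :
    Set (Measure (Euc d₀ × Euc d₁)) :=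
  {π | π.map Prod.fst = μ₀ ∧ π.map Prod.snd = μ₁}

/-- The cost function `c_A(x, y) = -4‖x‖²‖y‖² - 32 xᵀ A y`. -/
def cost {d₀ d₁ : ℕ} (A : Matrix (Fin d₀) (Fin d₁) ℝ) (z : Euc d₀ × Euc d₁) : ℝ :=
  -4 * ‖z.1‖ ^ 2 * ‖z.2‖ ^ 2 - 32 * (z.1.ofLp ⬝ᵥ (A *ᵥ z.2.ofLp))

/-- The transport cost `∫ c_A dπ` of a plan `π`. -/
def otObjective {d₀ d₁ : ℕ} (A : Matrix (Fin d₀) (Fin d₁) ℝ)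
    (π : Measure (Euc d₀ × Euc d₁)) : ℝ :=
  ∫ z, cost A z ∂π

/-- The unregularized optimal transport value `OT_{A,0}(μ₀, μ₁) = inf_π ∫ c_A dπ`. -/
def otValue {d₀ d₁ : ℕ} (μ₀ : Measure (Euc d₀)) (μ₁ : Measure (Euc d₁))
    (A : Matrix (Fin d₀) (Fin d₁) ℝ) : ℝ :=
  sInf (otObjective A '' couplings μ₀ μ₁)

/-- `π` solves the unregularized optimal transport problem `OT_{A,0}(μ₀, μ₁)`. -/
def SolvesOT {d₀ d₁ : ℕ} (μ₀ : Measure (Euc d₀)) (μ₁ : Measure (Euc d₁))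
    (A : Matrix (Fin d₀) (Fin d₁) ℝ) (π : Measure (Euc d₀ × Euc d₁)) : Prop :=
  π ∈ couplings μ₀ μ₁ ∧ IsMinOn (otObjective A) (couplings μ₀ μ₁) π

/-- `Φ₀(A) = 32 ‖A‖_F² + OT_{A,0}(μ₀, μ₁)`. -/
def Phi₀ {d₀ d₁ : ℕ} (μ₀ : Measure (Euc d₀)) (μ₁ : Measure (Euc d₁))
    (A : Matrix (Fin d₀) (Fin d₁) ℝ) : ℝ :=
  32 * ‖A‖ ^ 2 + otValue μ₀ μ₁ A

/-- The cross-correlation matrix `∫ x yᵀ dπ(x, y)`. -/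
def crossCorr {d₀ d₁ : ℕ} (π : Measure (Euc d₀ × Euc d₁)) : Matrix (Fin d₀) (Fin d₁) ℝ :=
  Matrix.of fun i j => ∫ z, z.1 i * z.2 j ∂π

/-- The second moment `M₂(μ) = ∫ ‖x‖² dμ(x)`. -/
def secondMoment {d : ℕ} (μ : Measure (Euc d)) : ℝ :=
  ∫ x, ‖x‖ ^ 2 ∂μ

/-- `𝒟_M = {A : ‖A‖_F ≤ M / 2}`. -/
def matrixBall (d₀ d₁ : ℕ) (M : ℝ) : Set (Matrix (Fin d₀) (Fin d₁) ℝ) :=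
  {A | ‖A‖ ≤ M / 2}

/-- The quadratic Gromov-Wasserstein objective
`∫ | ‖x - x'‖² - ‖y - y'‖² |² d(π ⊗ π)(x, y, x', y')`. -/
def gwObjective {d₀ d₁ : ℕ} (π : Measure (Euc d₀ × Euc d₁)) : ℝ :=
  ∫ w, |‖w.1.1 - w.2.1‖ ^ 2 - ‖w.1.2 - w.2.2‖ ^ 2| ^ 2 ∂(π.prod π)

/-- `π` solves the unregularized quadratic Gromov-Wasserstein problem `S₀(μ₀, μ₁)`. -/
def SolvesGW {d₀ d₁ : ℕ} (μ₀ : Measure (Euc d₀)) (μ₁ : Measure (Euc d₁))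
    (π : Measure (Euc d₀ × Euc d₁)) : Prop :=
  π ∈ couplings μ₀ μ₁ ∧ IsMinOn gwObjective (couplings μ₀ μ₁) π

end GromovWasserstein

end

open Filter Topology

namespace GromovWasserstein

/-! For a fixed coupling `π` with cross-correlation `C`, completing the square
(`norm_sq_add_otObjective_eq`) turns `32‖A‖² + ∫ c_A dπ` into `32‖A - C/2‖²` plus a residual free of
`A`. Thus `Φ₀` is a minimum over `π` of paraboloids centered at `C/2`. If `π` is optimal at a local
minimizer `A`, its paraboloid lies above `Φ₀` and touches it at `A`, so `A` must be its center
(`eq_half_crossCorr_of_isLocalMin`). Cauchy–Schwarz bounds `‖C‖` and hence `‖A‖`. For centered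
marginals the Gromov–Wasserstein objective is a constant of the marginals plus that same residual
(`gwObjective_eq`), so minimizing jointly over `A` and `π` solves both problems. -/

theorem integrable_of_ae_mem_isCompact {X : Type*} [TopologicalSpace X] [T2Space X]
    [MeasurableSpace X] [BorelSpace X] {ν : Measure X} [IsFiniteMeasure ν] {K : Set X}
    (hK : IsCompact K) (hν : ∀ᵐ z ∂ν, z ∈ K) {f : X → ℝ} (hf : Continuous f) :
    Integrable f ν := by
  rw [← Measure.restrict_eq_self_of_ae_mem hν]
  exact hf.continuousOn.integrableOn_compact hK

variable {d₀ d₁ : ℕ} {μ₀ : Measure (Euc d₀)} {μ₁ : Measure (Euc d₁)}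
  {π : Measure (Euc d₀ × Euc d₁)}

theorem isProbabilityMeasure_of_mem_couplings [IsProbabilityMeasure μ₀]
    (hπ : π ∈ couplings μ₀ μ₁) : IsProbabilityMeasure π := by
  refine ⟨?_⟩
  have h : π.map Prod.fst Set.univ = 1 := by rw [hπ.1]; exact measure_univ
  rwa [Measure.map_apply measurable_fst MeasurableSet.univ, Set.preimage_univ] at h

theorem prod_mem_couplings [IsProbabilityMeasure μ₀] [IsProbabilityMeasure μ₁] :
    μ₀.prod μ₁ ∈ couplings μ₀ μ₁ := by
  constructor <;> simp

theorem ae_mem_support_prod (hπ : π ∈ couplings μ₀ μ₁) :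
    ∀ᵐ z ∂π, z ∈ μ₀.support ×ˢ μ₁.support := by
  have h₀ : ∀ᵐ x ∂(π.map Prod.fst), x ∈ μ₀.support := by
    rw [hπ.1]; exact Measure.support_mem_ae
  have h₁ : ∀ᵐ x ∂(π.map Prod.snd), x ∈ μ₁.support := by
    rw [hπ.2]; exact Measure.support_mem_ae
  filter_upwards [ae_of_ae_map measurable_fst.aemeasurable h₀,
    ae_of_ae_map measurable_snd.aemeasurable h₁] with z hz₀ hz₁ using ⟨hz₀, hz₁⟩

theorem integrable_coupling [IsProbabilityMeasure μ₀] (hμ₀ : IsCompact μ₀.support)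
    (hμ₁ : IsCompact μ₁.support) (hπ : π ∈ couplings μ₀ μ₁) {f : Euc d₀ × Euc d₁ → ℝ}
    (hf : Continuous f) : Integrable f π :=
  have := isProbabilityMeasure_of_mem_couplings hπ
  integrable_of_ae_mem_isCompact (hμ₀.prod hμ₁) (ae_mem_support_prod hπ) hf

theorem integrable_coupling_prod [IsProbabilityMeasure μ₀] (hμ₀ : IsCompact μ₀.support)
    (hμ₁ : IsCompact μ₁.support) (hπ : π ∈ couplings μ₀ μ₁)
    {f : (Euc d₀ × Euc d₁) × (Euc d₀ × Euc d₁) → ℝ} (hf : Continuous f) :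
    Integrable f (π.prod π) := by
  have := isProbabilityMeasure_of_mem_couplings hπ
  have hae := ae_mem_support_prod hπ
  refine integrable_of_ae_mem_isCompact ((hμ₀.prod hμ₁).prod (hμ₀.prod hμ₁)) ?_ hf
  filter_upwards [Measure.quasiMeasurePreserving_fst.ae hae,
    Measure.quasiMeasurePreserving_snd.ae hae] with w h₁ h₂ using ⟨h₁, h₂⟩

/-! ### Weak compactness of couplings and existence of optimal plans. -/

/-- Prokhorov: taking marginals is weakly continuous, which gives closedness, and tightness follows
from that of the two fixed marginals. -/
theorem isCompact_couplings (μ₀ : Measure (Euc d₀)) (μ₁ : Measure (Euc d₁))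
    [IsProbabilityMeasure μ₀] [IsProbabilityMeasure μ₁] :
    IsCompact {P : ProbabilityMeasure (Euc d₀ × Euc d₁) |
      (P : Measure (Euc d₀ × Euc d₁)) ∈ couplings μ₀ μ₁} := by
  set S := {P : ProbabilityMeasure (Euc d₀ × Euc d₁) |
      (P : Measure (Euc d₀ × Euc d₁)) ∈ couplings μ₀ μ₁} with hS
  have hclosed : IsClosed S := by
    have h₀ : IsClosed {P : ProbabilityMeasure (Euc d₀ × Euc d₁) |
        P.map continuous_fst.aemeasurable = (⟨μ₀, inferInstance⟩ : ProbabilityMeasure _)} :=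
      isClosed_eq (ProbabilityMeasure.continuous_map continuous_fst) continuous_const
    have h₁ : IsClosed {P : ProbabilityMeasure (Euc d₀ × Euc d₁) |
        P.map continuous_snd.aemeasurable = (⟨μ₁, inferInstance⟩ : ProbabilityMeasure _)} :=
      isClosed_eq (ProbabilityMeasure.continuous_map continuous_snd) continuous_const
    convert h₀.inter h₁ using 1
    ext P
    simp only [hS, couplings, Set.mem_inter_iff, Set.mem_ofPred_eq]
    have e₀ := (ProbabilityMeasure.toMeasure_injective.eq_iff
      (a := P.map continuous_fst.aemeasurable) (b := ⟨μ₀, inferInstance⟩))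
    have e₁ := (ProbabilityMeasure.toMeasure_injective.eq_iff
      (a := P.map continuous_snd.aemeasurable) (b := ⟨μ₁, inferInstance⟩))
    rw [ProbabilityMeasure.toMeasure_map, ProbabilityMeasure.coe_mk] at e₀ e₁
    exact and_congr e₀ e₁
  rw [← hclosed.closure_eq]
  refine isCompact_closure_of_isTightMeasureSet ?_
  refine IsTightMeasureSet.prodMk ?_ ?_
  · refine (isTightMeasureSet_singleton (μ := μ₀)).subset ?_
    rintro _ ⟨_, ⟨P, hP, rfl⟩, rfl⟩
    exact hP.1
  · refine (isTightMeasureSet_singleton (μ := μ₁)).subset ?_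
    rintro _ ⟨_, ⟨P, hP, rfl⟩, rfl⟩
    exact hP.2

/-- On compactly supported marginals, a continuous cost admits an optimal coupling. -/
theorem exists_isMinOn_couplings [IsProbabilityMeasure μ₀] [IsProbabilityMeasure μ₁]
    (hμ₀ : IsCompact μ₀.support) (hμ₁ : IsCompact μ₁.support) {c : Euc d₀ × Euc d₁ → ℝ}
    (hc : Continuous c) :
    ∃ π ∈ couplings μ₀ μ₁, IsMinOn (fun π => ∫ z, c z ∂π) (couplings μ₀ μ₁) π := by
  obtain ⟨C, hC⟩ := (hμ₀.prod hμ₁).exists_bound_of_continuousOn hc.continuousOn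
  -- Weak convergence tests only bounded functions, so `c` is truncated at a level that leaves it
  -- unchanged on the product of the supports. The bound `C` comes with no sign, hence `|C|`.
  let g : BoundedContinuousFunction (Euc d₀ × Euc d₁) ℝ :=
    BoundedContinuousFunction.ofNormedAddCommGroup (fun z => max (-|C|) (min |C| (c z)))
      (by fun_prop) |C| (fun z => by
        rw [Real.norm_eq_abs, abs_le]
        exact ⟨le_max_left _ _, max_le (by linarith [abs_nonneg C]) (min_le_left _ _)⟩)
  have hg : ∀ π ∈ couplings μ₀ μ₁, ∫ z, g z ∂π = ∫ z, c z ∂π := by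
    intro π hπ
    refine integral_congr_ae ?_
    filter_upwards [ae_mem_support_prod hπ] with z hz
    have h := abs_le.1 ((hC z hz).trans (le_abs_self C))
    change max (-|C|) (min |C| (c z)) = c z
    rw [min_eq_right h.2, max_eq_right h.1]
  obtain ⟨P, hP, hmin⟩ := (isCompact_couplings μ₀ μ₁).exists_isMinOn
    ⟨⟨μ₀.prod μ₁, inferInstance⟩, prod_mem_couplings⟩
    (ProbabilityMeasure.continuous_integral_boundedContinuousFunction g).continuousOn
  refine ⟨P, hP, fun ρ hρ => ?_⟩
  have h := hmin (a := ⟨ρ, isProbabilityMeasure_of_mem_couplings hρ⟩) hρ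
  simp only [Set.mem_ofPred_eq] at h ⊢
  rw [← hg _ hP, ← hg _ hρ]
  exact h

theorem continuous_cost (A : Matrix (Fin d₀) (Fin d₁) ℝ) : Continuous (cost A) := by
  unfold cost dotProduct mulVec dotProduct
  fun_prop

theorem exists_solvesOT [IsProbabilityMeasure μ₀] [IsProbabilityMeasure μ₁]
    (hμ₀ : IsCompact μ₀.support) (hμ₁ : IsCompact μ₁.support)
    (A : Matrix (Fin d₀) (Fin d₁) ℝ) : ∃ π, SolvesOT μ₀ μ₁ A π :=
  exists_isMinOn_couplings hμ₀ hμ₁ (continuous_cost A)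

theorem SolvesOT.isLeast {A : Matrix (Fin d₀) (Fin d₁) ℝ} (h : SolvesOT μ₀ μ₁ A π) :
    IsLeast (otObjective A '' couplings μ₀ μ₁) (otObjective A π) :=
  ⟨⟨π, h.1, rfl⟩, by rintro _ ⟨ρ, hρ, rfl⟩; exact h.2 hρ⟩

theorem SolvesOT.otValue_eq {A : Matrix (Fin d₀) (Fin d₁) ℝ} (h : SolvesOT μ₀ μ₁ A π) :
    otValue μ₀ μ₁ A = otObjective A π :=
  h.isLeast.csInf_eq

/-- A real `sInf` is a lower bound only for sets bounded below; here the attained minimum settles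
this. -/
theorem otValue_le [IsProbabilityMeasure μ₀] [IsProbabilityMeasure μ₁]
    (hμ₀ : IsCompact μ₀.support) (hμ₁ : IsCompact μ₁.support)
    (A : Matrix (Fin d₀) (Fin d₁) ℝ) (hπ : π ∈ couplings μ₀ μ₁) :
    otValue μ₀ μ₁ A ≤ otObjective A π := by
  obtain ⟨ρ, hρ⟩ := exists_solvesOT hμ₀ hμ₁ A
  rw [hρ.otValue_eq]
  exact hρ.2 hπ

/-! ### Completing the square and the first-order condition. -/

theorem frobenius_norm_sq (A : Matrix (Fin d₀) (Fin d₁) ℝ) :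
    ‖A‖ ^ 2 = ∑ i, ∑ j, A i j ^ 2 := by
  rw [Matrix.frobenius_norm_def, ← Real.sqrt_eq_rpow, Real.sq_sqrt (by positivity)]
  simp

/-- The mixed moment `∫ ‖x‖² ‖y‖² dπ(x, y)`. -/
noncomputable def mixedMoment (π : Measure (Euc d₀ × Euc d₁)) : ℝ :=
  ∫ z, ‖z.1‖ ^ 2 * ‖z.2‖ ^ 2 ∂π

theorem otObjective_eq [IsProbabilityMeasure μ₀] (hμ₀ : IsCompact μ₀.support)
    (hμ₁ : IsCompact μ₁.support) (A : Matrix (Fin d₀) (Fin d₁) ℝ)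
    (hπ : π ∈ couplings μ₀ μ₁) :
    otObjective A π = -4 * mixedMoment π - 32 * ∑ i, ∑ j, A i j * crossCorr π i j := by
  have hI : ∀ {f : Euc d₀ × Euc d₁ → ℝ}, Continuous f → Integrable f π :=
    fun hf => integrable_coupling hμ₀ hμ₁ hπ hf
  have hcost : ∀ z : Euc d₀ × Euc d₁, cost A z =
      -4 * (‖z.1‖ ^ 2 * ‖z.2‖ ^ 2) - 32 * ∑ i, ∑ j, A i j * (z.1 i * z.2 j) := by
    intro z
    simp only [cost, dotProduct, mulVec, Finset.mul_sum]
    congr 1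
    · ring
    · exact Finset.sum_congr rfl fun i _ => Finset.sum_congr rfl fun j _ => by ring
  simp only [otObjective, hcost, mixedMoment, crossCorr, Matrix.of_apply]
  rw [integral_sub (hI (by fun_prop)) (hI (by fun_prop)), integral_const_mul,
    integral_const_mul, integral_finsetSum _ fun i _ => hI (by fun_prop)]
  congr 2
  refine Finset.sum_congr rfl fun i _ => ?_
  rw [integral_finsetSum _ fun j _ => hI (by fun_prop)]
  exact Finset.sum_congr rfl fun j _ => integral_const_mul _ _

/-- Completing the square in the variational objective of a fixed plan. -/
theorem norm_sq_add_otObjective_eq [IsProbabilityMeasure μ₀] (hμ₀ : IsCompact μ₀.support)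
    (hμ₁ : IsCompact μ₁.support) (A : Matrix (Fin d₀) (Fin d₁) ℝ)
    (hπ : π ∈ couplings μ₀ μ₁) :
    32 * ‖A‖ ^ 2 + otObjective A π =
      32 * ‖A - (1 / 2 : ℝ) • crossCorr π‖ ^ 2 - 8 * ‖crossCorr π‖ ^ 2 - 4 * mixedMoment π := by
  have h : 32 * ∑ i, ∑ j, A i j ^ 2 - 32 * ∑ i, ∑ j, A i j * crossCorr π i j =
      32 * (∑ i, ∑ j, (A i j - 1 / 2 * crossCorr π i j) ^ 2)
        - 8 * ∑ i, ∑ j, crossCorr π i j ^ 2 := by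
    simp only [Finset.mul_sum, ← Finset.sum_sub_distrib]
    exact Finset.sum_congr rfl fun i _ => Finset.sum_congr rfl fun j _ => by ring
  rw [otObjective_eq hμ₀ hμ₁ A hπ, frobenius_norm_sq, frobenius_norm_sq, frobenius_norm_sq]
  simp only [Matrix.sub_apply, Matrix.smul_apply, smul_eq_mul]
  linarith

theorem eq_half_crossCorr_of_isLocalMin [IsProbabilityMeasure μ₀] [IsProbabilityMeasure μ₁]
    (hμ₀ : IsCompact μ₀.support) (hμ₁ : IsCompact μ₁.support)
    {A : Matrix (Fin d₀) (Fin d₁) ℝ} (hA : IsLocalMin (Phi₀ μ₀ μ₁) A)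
    (hπ : SolvesOT μ₀ μ₁ A π) : A = (1 / 2 : ℝ) • crossCorr π := by
  set C := (1 / 2 : ℝ) • crossCorr π with hC
  have hcont : Tendsto (fun t : ℝ => A - t • (A - C)) (𝓝[>] 0) (𝓝 A) := by
    have h : Continuous fun t : ℝ => A - t • (A - C) := by fun_prop
    have := h.tendsto 0
    simp only [zero_smul, sub_zero] at this
    exact this.mono_left nhdsWithin_le_nhds
  -- A short move from `A` towards `C` stays in the neighborhood of local minimality, yet scales the
  -- squared distance to `C` by `(1 - t)²`.
  obtain ⟨t, hle, ht⟩ := ((hcont.eventually hA).and (Ioo_mem_nhdsGT one_pos)).exists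
  have h₁ : Phi₀ μ₀ μ₁ (A - t • (A - C)) ≤
      32 * ‖A - t • (A - C)‖ ^ 2 + otObjective (A - t • (A - C)) π :=
    add_le_add_right (otValue_le hμ₀ hμ₁ _ hπ.1) _
  have h₂ : Phi₀ μ₀ μ₁ A = 32 * ‖A‖ ^ 2 + otObjective A π := by
    rw [Phi₀, hπ.otValue_eq]
  rw [norm_sq_add_otObjective_eq hμ₀ hμ₁ _ hπ.1, ← hC] at h₁ h₂
  have h₃ : ‖A - t • (A - C) - C‖ ^ 2 = (1 - t) ^ 2 * ‖A - C‖ ^ 2 := by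
    rw [frobenius_norm_sq, frobenius_norm_sq]
    simp only [Matrix.sub_apply, Matrix.smul_apply, smul_eq_mul, Finset.mul_sum]
    exact Finset.sum_congr rfl fun i _ => Finset.sum_congr rfl fun j _ => by ring
  rw [h₃] at h₁
  have h₄ : ‖A - C‖ ^ 2 ≤ (1 - t) ^ 2 * ‖A - C‖ ^ 2 := by linarith
  -- `t(2 - t) = 1 - (1 - t)²`.
  have h₅ : 0 < t * (2 - t) := mul_pos ht.1 (by linarith [ht.2])
  have h₆ : ‖A - C‖ ^ 2 ≤ 0 := by
    refine le_of_mul_le_mul_left ?_ h₅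
    linarith
  exact sub_eq_zero.1 (norm_eq_zero.1 (pow_eq_zero_iff two_ne_zero |>.1
    (le_antisymm h₆ (sq_nonneg _))))

/-! ### Bounding the cross-correlation by second moments. -/

/-- The quadratic `t ↦ ∫ (f + t g)²` is nonnegative, so its discriminant is at most zero. -/
theorem sq_integral_mul_le {X : Type*} [MeasurableSpace X] {ν : Measure X} {f g : X → ℝ}
    (hff : Integrable (fun x => f x ^ 2) ν) (hgg : Integrable (fun x => g x ^ 2) ν)
    (hfg : Integrable (fun x => f x * g x) ν) :
    (∫ x, f x * g x ∂ν) ^ 2 ≤ (∫ x, f x ^ 2 ∂ν) * ∫ x, g x ^ 2 ∂ν := by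
  have h : ∀ t : ℝ, 0 ≤ (∫ x, g x ^ 2 ∂ν) * (t * t) + (2 * ∫ x, f x * g x ∂ν) * t
      + ∫ x, f x ^ 2 ∂ν := by
    intro t
    have h₀ : 0 ≤ ∫ x, (f x + t * g x) ^ 2 ∂ν := integral_nonneg fun x => sq_nonneg _
    have h₁ : ∀ x, (f x + t * g x) ^ 2 = t * t * g x ^ 2 + 2 * t * (f x * g x) + f x ^ 2 :=
      fun x => by ring
    simp only [h₁] at h₀
    rw [integral_add (by exact (hgg.const_mul _).add (hfg.const_mul _)) hff,
      integral_add (hgg.const_mul _) (hfg.const_mul _), integral_const_mul,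
      integral_const_mul] at h₀
    linarith
  have := discrim_le_zero h
  rw [discrim] at this
  linarith

theorem integral_comp_fst (hπ : π ∈ couplings μ₀ μ₁) {f : Euc d₀ → ℝ} (hf : Continuous f) :
    ∫ z, f z.1 ∂π = ∫ x, f x ∂μ₀ := by
  rw [← hπ.1, integral_map measurable_fst.aemeasurable hf.aestronglyMeasurable]

theorem integral_comp_snd (hπ : π ∈ couplings μ₀ μ₁) {f : Euc d₁ → ℝ} (hf : Continuous f) :
    ∫ z, f z.2 ∂π = ∫ y, f y ∂μ₁ := by
  rw [← hπ.2, integral_map measurable_snd.aemeasurable hf.aestronglyMeasurable]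

/-- Cauchy–Schwarz applies entry by entry, and the resulting double sum factors. -/
theorem norm_sq_crossCorr_le [IsProbabilityMeasure μ₀] (hμ₀ : IsCompact μ₀.support)
    (hμ₁ : IsCompact μ₁.support) (hπ : π ∈ couplings μ₀ μ₁) :
    ‖crossCorr π‖ ^ 2 ≤ secondMoment μ₀ * secondMoment μ₁ := by
  have hI : ∀ {f : Euc d₀ × Euc d₁ → ℝ}, Continuous f → Integrable f π :=
    fun hf => integrable_coupling hμ₀ hμ₁ hπ hf
  have h₀ : secondMoment μ₀ = ∑ i, ∫ z, z.1 i ^ 2 ∂π := by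
    rw [secondMoment, ← integral_comp_fst hπ (by fun_prop),
      ← integral_finsetSum _ fun i _ => hI (by fun_prop)]
    simp only [EuclideanSpace.real_norm_sq_eq]
  have h₁ : secondMoment μ₁ = ∑ j, ∫ z, z.2 j ^ 2 ∂π := by
    rw [secondMoment, ← integral_comp_snd hπ (by fun_prop),
      ← integral_finsetSum _ fun i _ => hI (by fun_prop)]
    simp only [EuclideanSpace.real_norm_sq_eq]
  rw [frobenius_norm_sq, h₀, h₁, Finset.sum_mul_sum]
  exact Finset.sum_le_sum fun i _ => Finset.sum_le_sum fun j _ =>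
    sq_integral_mul_le (hI (by fun_prop)) (hI (by fun_prop)) (hI (by fun_prop))

/-! ### Expanding the Gromov–Wasserstein objective for centered marginals. -/

theorem integral_coord_eq_zero {d : ℕ} {μ : Measure (Euc d)} [IsProbabilityMeasure μ]
    (hμ : IsCompact μ.support) (h0 : ∫ x, x ∂μ = 0) (i : Fin d) : ∫ x, x i ∂μ = 0 := by
  have hint : Integrable (fun x : Euc d => x) μ := by
    rw [← Measure.restrict_eq_self_of_ae_mem (Measure.support_mem_ae (μ := μ))]
    exact continuous_id.continuousOn.integrableOn_compact hμ
  have h := (EuclideanSpace.proj (𝕜 := ℝ) i).integral_comp_comm hint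
  rw [h0, map_zero] at h
  exact h

/-- For centered marginals, the Fubini expansion of the cross term of the
Gromov-Wasserstein objective. -/
theorem integral_cross_term [IsProbabilityMeasure μ₀] [IsProbabilityMeasure μ₁]
    (hμ₀ : IsCompact μ₀.support) (hμ₁ : IsCompact μ₁.support)
    (h₀ : ∫ x, x ∂μ₀ = 0) (h₁ : ∫ y, y ∂μ₁ = 0) (hπ : π ∈ couplings μ₀ μ₁) :
    ∫ w, ‖w.1.1 - w.2.1‖ ^ 2 * ‖w.1.2 - w.2.2‖ ^ 2 ∂(π.prod π) =
      2 * mixedMoment π + 2 * (secondMoment μ₀ * secondMoment μ₁)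
        + 4 * ‖crossCorr π‖ ^ 2 := by
  have := isProbabilityMeasure_of_mem_couplings hπ
  have hI : ∀ {f : (Euc d₀ × Euc d₁) × (Euc d₀ × Euc d₁) → ℝ}, Continuous f →
      Integrable f (π.prod π) := fun hf => integrable_coupling_prod hμ₀ hμ₁ hπ hf
  have hx : ∀ i, ∫ z, z.1 i ∂π = 0 := fun i => by
    rw [integral_comp_fst (f := fun x => x i) hπ (by fun_prop)]
    exact integral_coord_eq_zero hμ₀ h₀ i
  have hy : ∀ j, ∫ z, z.2 j ∂π = 0 := fun j => by
    rw [integral_comp_snd (f := fun y => y j) hπ (by fun_prop)]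
    exact integral_coord_eq_zero hμ₁ h₁ j
  have hp : ∫ z, ‖z.1‖ ^ 2 ∂π = secondMoment μ₀ :=
    integral_comp_fst (f := fun x => ‖x‖ ^ 2) hπ (by fun_prop)
  have hq : ∫ z, ‖z.2‖ ^ 2 ∂π = secondMoment μ₁ :=
    integral_comp_snd (f := fun y => ‖y‖ ^ 2) hπ (by fun_prop)
  have hmul : ∀ f g : Euc d₀ × Euc d₁ → ℝ,
      ∫ w, f w.1 * g w.2 ∂(π.prod π) = (∫ z, f z ∂π) * ∫ z, g z ∂π :=
    fun f g => integral_prod_mul f g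
  -- Each term is shaped as `f w.1 * g w.2` up to commutation, padded by `1` where needed, so that
  -- it integrates by `hmul`.
  have hexp : ∀ w : (Euc d₀ × Euc d₁) × (Euc d₀ × Euc d₁),
      ‖w.1.1 - w.2.1‖ ^ 2 * ‖w.1.2 - w.2.2‖ ^ 2 =
        (‖w.1.1‖ ^ 2 * ‖w.1.2‖ ^ 2) * 1 + 1 * (‖w.2.1‖ ^ 2 * ‖w.2.2‖ ^ 2)
        + ‖w.1.1‖ ^ 2 * ‖w.2.2‖ ^ 2 + ‖w.1.2‖ ^ 2 * ‖w.2.1‖ ^ 2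
        - 2 * ∑ i, (w.1.1 i * ‖w.1.2‖ ^ 2) * w.2.1 i
        - 2 * ∑ i, w.1.1 i * (w.2.1 i * ‖w.2.2‖ ^ 2)
        - 2 * ∑ j, (w.1.2 j * ‖w.1.1‖ ^ 2) * w.2.2 j
        - 2 * ∑ j, w.1.2 j * (w.2.2 j * ‖w.2.1‖ ^ 2)
        + 4 * ∑ i, ∑ j, (w.1.1 i * w.1.2 j) * (w.2.1 i * w.2.2 j) := by
    rintro ⟨⟨x, y⟩, ⟨x', y'⟩⟩
    have e₀ : inner ℝ x x' = ∑ i, x i * x' i := by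
      simp [PiLp.inner_apply, mul_comm]
    have e₁ : inner ℝ y y' = ∑ j, y j * y' j := by
      simp [PiLp.inner_apply, mul_comm]
    have s₁ : ∑ i, (x i * ‖y‖ ^ 2) * x' i = ‖y‖ ^ 2 * inner ℝ x x' := by
      rw [e₀, Finset.mul_sum]; exact Finset.sum_congr rfl fun i _ => by ring
    have s₂ : ∑ i, x i * (x' i * ‖y'‖ ^ 2) = ‖y'‖ ^ 2 * inner ℝ x x' := by
      rw [e₀, Finset.mul_sum]; exact Finset.sum_congr rfl fun i _ => by ring
    have s₃ : ∑ j, (y j * ‖x‖ ^ 2) * y' j = ‖x‖ ^ 2 * inner ℝ y y' := by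
      rw [e₁, Finset.mul_sum]; exact Finset.sum_congr rfl fun i _ => by ring
    have s₄ : ∑ j, y j * (y' j * ‖x'‖ ^ 2) = ‖x'‖ ^ 2 * inner ℝ y y' := by
      rw [e₁, Finset.mul_sum]; exact Finset.sum_congr rfl fun i _ => by ring
    have s₅ : ∑ i, ∑ j, (x i * y j) * (x' i * y' j) = inner ℝ x x' * inner ℝ y y' := by
      rw [e₀, e₁, Finset.sum_mul_sum]
      exact Finset.sum_congr rfl fun i _ => Finset.sum_congr rfl fun j _ => by ring
    simp only [s₁, s₂, s₃, s₄, s₅]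
    rw [norm_sub_sq_real, norm_sub_sq_real]
    ring
  simp only [hexp]
  rw [integral_add (hI (by fun_prop)) (hI (by fun_prop)),
    integral_sub (hI (by fun_prop)) (hI (by fun_prop)),
    integral_sub (hI (by fun_prop)) (hI (by fun_prop)),
    integral_sub (hI (by fun_prop)) (hI (by fun_prop)),
    integral_sub (hI (by fun_prop)) (hI (by fun_prop)),
    integral_add (hI (by fun_prop)) (hI (by fun_prop)),
    integral_add (hI (by fun_prop)) (hI (by fun_prop)),
    integral_add (hI (by fun_prop)) (hI (by fun_prop))]
  simp only [integral_const_mul (2 : ℝ), integral_const_mul (4 : ℝ)]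
  rw [integral_finsetSum _ fun i _ => hI (by fun_prop),
    integral_finsetSum _ fun i _ => hI (by fun_prop),
    integral_finsetSum _ fun i _ => hI (by fun_prop),
    integral_finsetSum _ fun i _ => hI (by fun_prop),
    integral_finsetSum _ fun i _ => hI (by fun_prop)]
  have t₁ : ∫ w : (Euc d₀ × Euc d₁) × (Euc d₀ × Euc d₁),
      (‖w.1.1‖ ^ 2 * ‖w.1.2‖ ^ 2) * 1 ∂(π.prod π) = mixedMoment π := by
    rw [hmul (fun z => ‖z.1‖ ^ 2 * ‖z.2‖ ^ 2) fun _ => 1]; simp [mixedMoment]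
  have t₂ : ∫ w : (Euc d₀ × Euc d₁) × (Euc d₀ × Euc d₁),
      1 * (‖w.2.1‖ ^ 2 * ‖w.2.2‖ ^ 2) ∂(π.prod π) = mixedMoment π := by
    rw [hmul (fun _ => 1) fun z => ‖z.1‖ ^ 2 * ‖z.2‖ ^ 2]; simp [mixedMoment]
  have t₃ : ∫ w : (Euc d₀ × Euc d₁) × (Euc d₀ × Euc d₁),
      ‖w.1.1‖ ^ 2 * ‖w.2.2‖ ^ 2 ∂(π.prod π) = secondMoment μ₀ * secondMoment μ₁ := by
    rw [hmul (fun z => ‖z.1‖ ^ 2) fun z => ‖z.2‖ ^ 2, hp, hq]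
  have t₄ : ∫ w : (Euc d₀ × Euc d₁) × (Euc d₀ × Euc d₁),
      ‖w.1.2‖ ^ 2 * ‖w.2.1‖ ^ 2 ∂(π.prod π) = secondMoment μ₀ * secondMoment μ₁ := by
    rw [hmul (fun z => ‖z.2‖ ^ 2) fun z => ‖z.1‖ ^ 2, hp, hq, mul_comm]
  -- Centering enters here: `t₅` to `t₈` each contain a first moment as a factor.
  have t₅ : ∀ i, ∫ w : (Euc d₀ × Euc d₁) × (Euc d₀ × Euc d₁),
      (w.1.1 i * ‖w.1.2‖ ^ 2) * w.2.1 i ∂(π.prod π) = 0 := fun i => by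
    rw [hmul (fun z => z.1 i * ‖z.2‖ ^ 2) fun z => z.1 i, hx, mul_zero]
  have t₆ : ∀ i, ∫ w : (Euc d₀ × Euc d₁) × (Euc d₀ × Euc d₁),
      w.1.1 i * (w.2.1 i * ‖w.2.2‖ ^ 2) ∂(π.prod π) = 0 := fun i => by
    rw [hmul (fun z => z.1 i) fun z => z.1 i * ‖z.2‖ ^ 2, hx, zero_mul]
  have t₇ : ∀ j, ∫ w : (Euc d₀ × Euc d₁) × (Euc d₀ × Euc d₁),
      (w.1.2 j * ‖w.1.1‖ ^ 2) * w.2.2 j ∂(π.prod π) = 0 := fun j => by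
    rw [hmul (fun z => z.2 j * ‖z.1‖ ^ 2) fun z => z.2 j, hy, mul_zero]
  have t₈ : ∀ j, ∫ w : (Euc d₀ × Euc d₁) × (Euc d₀ × Euc d₁),
      w.1.2 j * (w.2.2 j * ‖w.2.1‖ ^ 2) ∂(π.prod π) = 0 := fun j => by
    rw [hmul (fun z => z.2 j) fun z => z.2 j * ‖z.1‖ ^ 2, hy, zero_mul]
  have t₉ : ∑ i, ∫ w : (Euc d₀ × Euc d₁) × (Euc d₀ × Euc d₁),
      ∑ j, (w.1.1 i * w.1.2 j) * (w.2.1 i * w.2.2 j) ∂(π.prod π) = ‖crossCorr π‖ ^ 2 := by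
    rw [frobenius_norm_sq]
    refine Finset.sum_congr rfl fun i _ => ?_
    rw [integral_finsetSum _ fun j _ => hI (by fun_prop)]
    refine Finset.sum_congr rfl fun j _ => ?_
    rw [hmul (fun z => z.1 i * z.2 j) fun z => z.1 i * z.2 j, sq]
    rfl
  simp only [t₁, t₂, t₃, t₄, t₅, t₆, t₇, t₈, t₉, Finset.sum_const_zero]
  ring

/-- For centered marginals, the Gromov-Wasserstein objective is a constant depending only on the
marginals, plus the value of the variational objective at its minimizer. -/
theorem gwObjective_eq [IsProbabilityMeasure μ₀] [IsProbabilityMeasure μ₁]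
    (hμ₀ : IsCompact μ₀.support) (hμ₁ : IsCompact μ₁.support)
    (h₀ : ∫ x, x ∂μ₀ = 0) (h₁ : ∫ y, y ∂μ₁ = 0) (hπ : π ∈ couplings μ₀ μ₁) :
    gwObjective π =
      (∫ p, ‖p.1 - p.2‖ ^ 4 ∂(μ₀.prod μ₀)) + (∫ p, ‖p.1 - p.2‖ ^ 4 ∂(μ₁.prod μ₁))
        - 4 * (secondMoment μ₀ * secondMoment μ₁)
        + (-8 * ‖crossCorr π‖ ^ 2 - 4 * mixedMoment π) := by
  have := isProbabilityMeasure_of_mem_couplings hπ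
  have hI : ∀ {f : (Euc d₀ × Euc d₁) × (Euc d₀ × Euc d₁) → ℝ}, Continuous f →
      Integrable f (π.prod π) := fun hf => integrable_coupling_prod hμ₀ hμ₁ hπ hf
  -- The pure fourth powers see only one marginal, so they are the same for all couplings.
  have e₀ : ∫ w, ‖w.1.1 - w.2.1‖ ^ 4 ∂(π.prod π) = ∫ p, ‖p.1 - p.2‖ ^ 4 ∂(μ₀.prod μ₀) := by
    rw [← hπ.1, Measure.map_prod_map _ _ measurable_fst measurable_fst, integral_map
      (by fun_prop) (Continuous.aestronglyMeasurable (by fun_prop))]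
    rfl
  have e₁ : ∫ w, ‖w.1.2 - w.2.2‖ ^ 4 ∂(π.prod π) = ∫ p, ‖p.1 - p.2‖ ^ 4 ∂(μ₁.prod μ₁) := by
    rw [← hπ.2, Measure.map_prod_map _ _ measurable_snd measurable_snd, integral_map
      (by fun_prop) (Continuous.aestronglyMeasurable (by fun_prop))]
    rfl
  have hexp : ∀ w : (Euc d₀ × Euc d₁) × (Euc d₀ × Euc d₁),
      |‖w.1.1 - w.2.1‖ ^ 2 - ‖w.1.2 - w.2.2‖ ^ 2| ^ 2 =
        ‖w.1.1 - w.2.1‖ ^ 4 + ‖w.1.2 - w.2.2‖ ^ 4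
          - 2 * (‖w.1.1 - w.2.1‖ ^ 2 * ‖w.1.2 - w.2.2‖ ^ 2) := fun w => by
    rw [sq_abs]; ring
  simp only [gwObjective, hexp]
  rw [integral_sub (hI (by fun_prop)) (hI (by fun_prop)),
    integral_add (hI (by fun_prop)) (hI (by fun_prop)), integral_const_mul, e₀, e₁,
    integral_cross_term hμ₀ hμ₁ h₀ h₁ hπ]
  ring

end GromovWasserstein

theorem mainTheorem9 {d₀ d₁ : ℕ}
    (μ₀ : Measure (GromovWasserstein.Euc d₀)) (μ₁ : Measure (GromovWasserstein.Euc d₁))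
    [IsProbabilityMeasure μ₀] [IsProbabilityMeasure μ₁]
    (hμ₀ : IsCompact μ₀.support) (hμ₁ : IsCompact μ₁.support)
    (A : Matrix (Fin d₀) (Fin d₁) ℝ)
    (hA : IsLocalMin (GromovWasserstein.Phi₀ μ₀ μ₁) A) :
    (∃ π : Measure (GromovWasserstein.Euc d₀ × GromovWasserstein.Euc d₁),
      GromovWasserstein.SolvesOT μ₀ μ₁ A π ∧
      A = (1 / 2 : ℝ) • GromovWasserstein.crossCorr π) ∧
    (∀ M : ℝ, √(GromovWasserstein.secondMoment μ₀ * GromovWasserstein.secondMoment μ₁) < M →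
      A ∈ GromovWasserstein.matrixBall d₀ d₁ M) ∧
    ((∀ B : Matrix (Fin d₀) (Fin d₁) ℝ,
        GromovWasserstein.Phi₀ μ₀ μ₁ A ≤ GromovWasserstein.Phi₀ μ₀ μ₁ B) →
      ∫ x, x ∂μ₀ = 0 → ∫ y, y ∂μ₁ = 0 →
      ∀ π : Measure (GromovWasserstein.Euc d₀ × GromovWasserstein.Euc d₁),
        GromovWasserstein.SolvesOT μ₀ μ₁ A π →
        A = (1 / 2 : ℝ) • GromovWasserstein.crossCorr π →
        GromovWasserstein.SolvesGW μ₀ μ₁ π) := by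
  open GromovWasserstein in
  refine ⟨?_, fun M hM => ?_, fun hglob h₀ h₁ π hπ hAπ => ⟨hπ.1, fun ρ hρ => ?_⟩⟩
  · obtain ⟨π, hπ⟩ := exists_solvesOT hμ₀ hμ₁ A
    exact ⟨π, hπ, eq_half_crossCorr_of_isLocalMin hμ₀ hμ₁ hA hπ⟩
  · obtain ⟨π, hπ⟩ := exists_solvesOT hμ₀ hμ₁ A
    have hle := Real.le_sqrt_of_sq_le (norm_sq_crossCorr_le hμ₀ hμ₁ hπ.1)
    have hnorm : ‖A‖ ^ 2 = (‖crossCorr π‖ / 2) ^ 2 := by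
      rw [eq_half_crossCorr_of_isLocalMin hμ₀ hμ₁ hA hπ, div_pow, frobenius_norm_sq,
        frobenius_norm_sq]
      simp only [Matrix.smul_apply, smul_eq_mul, mul_pow, ← Finset.mul_sum]
      ring
    have hnorm' : ‖A‖ = ‖crossCorr π‖ / 2 :=
      (pow_left_inj₀ (norm_nonneg _) (by positivity) two_ne_zero).1 hnorm
    change ‖A‖ ≤ M / 2
    linarith
  -- Global minimality is tested at the center of the paraboloid of `ρ`, where the square vanishes
  -- and only the residual of `ρ` remains.
  · have hle : Phi₀ μ₀ μ₁ A ≤ 32 * ‖(1 / 2 : ℝ) • crossCorr ρ‖ ^ 2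
        + otObjective ((1 / 2 : ℝ) • crossCorr ρ) ρ :=
      (hglob _).trans (add_le_add_right (otValue_le hμ₀ hμ₁ _ hρ) _)
    have hval : Phi₀ μ₀ μ₁ A = 32 * ‖A‖ ^ 2 + otObjective A π := by
      rw [Phi₀, hπ.otValue_eq]
    rw [norm_sq_add_otObjective_eq hμ₀ hμ₁ _ hρ, sub_self] at hle
    rw [norm_sq_add_otObjective_eq hμ₀ hμ₁ _ hπ.1, ← hAπ, sub_self] at hval
    change gwObjective π ≤ gwObjective ρ
    rw [gwObjective_eq hμ₀ hμ₁ h₀ h₁ hπ.1, gwObjective_eq hμ₀ hμ₁ h₀ h₁ hρ]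
    linarith
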